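/- Let $n\ge 1$ be an integer, let $B_n=\{x\in\mathbb R^n:\|x\|\le 1\}$ be the closed Euclidean unit ball, and let $\varkappa_n=\mathrm{vol}(B_n)$. Let $C(B_n)$ be the space of continuous functions $f:B_n\to\mathbb R$ with the uniform norm, and let $\Pi_1(\mathbb R^n)$ be the space of real polynomials in $n$ variables of degree at most $1$, regarded as functions on $B_n$. Let $\chi_n(t)=\frac{1}{2^n n!}\left[(t^2-1)^n\right]^{(n)}$ be the standardized Legendre polynomial of degree $n$; it maps $[1,+\infty)$ bijectively onto $[1,+\infty)$, and $\chi_n^{-1}:[1,+\infty)\to[1,+\infty)$ denotes the inverse of this restriction. Let $x^{(1)},\dots,x^{(n+1)}\in B_n$ be the vertices of a nondegenerate $n$-dimensional simplex $S\subset B_n$, let $\mathbf A$ be the $(n+1)\times(n+1)$ matrix whose $j$-th row is $(x^{(j)}_1,\dots,x^{(j)}_n,1)$, and let $P:C(B_n)\to\Pi_1(\mathbb R^n)$ be the corresponding interpolation projector, i.e. the bounded linear operator with $Pf(x^{(j)})=f(x^{(j)})$ for all $f\in C(B_n)$ and $1\le j\le n+1$. Denote by $\|P\|_{B_n}$ its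 norm as an operator from $C(B_n)$ to $C(B_n)$. Then $\varkappa_n/\mathrm{vol}(S)\ge 1$ and $$\|P\|_{B_n}\ \ge\ \chi_n^{-1}\left(\frac{\varkappa_n}{\mathrm{vol}(S)}\right)=\chi_n^{-1}\left(\frac{n!\,\varkappa_n}{|\det(\mathbf A)|}\right).$$ -/

import Mathlib

noncomputable section

/-- The closed unit ball `B_n` of the Euclidean space `ℝⁿ`. -/
abbrev unitBall (n : ℕ) : Set (EuclideanSpace ℝ (Fin n)) :=
  Metric.closedBall (0 : EuclideanSpace ℝ (Fin n)) 1

/-- The `i`-th coordinate function `x ↦ x_i`, as an element of `C(B_n)`. -/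
def coordFun (n : ℕ) (i : Fin n) : C(unitBall n, ℝ) where
  toFun x := (x : EuclideanSpace ℝ (Fin n)) i
  continuous_toFun := by fun_prop

/-- The space `Π₁(ℝⁿ)` of real polynomials in `n` variables of total degree at most `1`,
regarded (by restriction to `B_n`) as a subspace of `C(B_n)`. -/
def linearPolys (n : ℕ) : Submodule ℝ C(unitBall n, ℝ) :=
  (MvPolynomial.restrictTotalDegree (Fin n) ℝ 1).map
    (MvPolynomial.aeval (R := ℝ) (coordFun n)).toLinearMap

/-- `P : C(B_n) → Π₁(ℝⁿ)` is the interpolation projector with nodes `x 0, …, x n`: the nodes are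
points of `B_n` that are the vertices of a nondegenerate `n`-dimensional simplex, `P f` lies in
`Π₁(ℝⁿ)`, and `P f` takes the same values as `f` at the nodes. The operator norm `‖P‖` is the norm
of `P` as an operator from `C(B_n)` to `C(B_n)`. -/
structure IsInterpolationProjector {n : ℕ} (P : C(unitBall n, ℝ) →L[ℝ] C(unitBall n, ℝ))
    (x : Fin (n + 1) → unitBall n) : Prop where
  nondegenerate : AffineIndependent ℝ (fun j => (x j : EuclideanSpace ℝ (Fin n)))
  mem_linearPolys : ∀ f : C(unitBall n, ℝ), P f ∈ linearPolys n
  interpolates : ∀ (f : C(unitBall n, ℝ)) (j : Fin (n + 1)), P f (x j) = f (x j)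

/-- The simplex with the given vertices. -/
def simplexOf {n : ℕ} (x : Fin (n + 1) → unitBall n) : Set (EuclideanSpace ℝ (Fin n)) :=
  convexHull ℝ (Set.range fun j => (x j : EuclideanSpace ℝ (Fin n)))

/-- The vertices matrix: its `j`-th row is `(x_1^{(j)}, …, x_n^{(j)}, 1)`. -/
def verticesMatrix {n : ℕ} (x : Fin (n + 1) → unitBall n) :
    Matrix (Fin (n + 1)) (Fin (n + 1)) ℝ :=
  Matrix.of fun j =>
    Fin.snoc (α := fun _ => ℝ) (fun i : Fin n => (x j : EuclideanSpace ℝ (Fin n)) i) 1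

/-- The volume of a subset of `ℝⁿ`, as a real number. -/
def vol {n : ℕ} (s : Set (EuclideanSpace ℝ (Fin n))) : ℝ :=
  (MeasureTheory.volume s).toReal

/-- The standardized Legendre polynomial of degree `n` (Rodrigues formula),
`χ_n(t) = (1 / (2ⁿ n!)) [(t² - 1)ⁿ]^{(n)}`. -/
def legendreChi (n : ℕ) (t : ℝ) : ℝ :=
  1 / (2 ^ n * (n.factorial : ℝ)) * iteratedDeriv n (fun u : ℝ => (u ^ 2 - 1) ^ n) t

/-- The inverse of `χ_n` on the half-axis `[1, +∞)`. -/
def legendreChiInv (n : ℕ) (s : ℝ) : ℝ :=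
  Function.invFunOn (legendreChi n) (Set.Ici (1 : ℝ)) s

end

/-! Write a point of the ball in barycentric coordinates `w` with respect to `S`. Testing `P` on a
function bounded by 1 with values `sign (w j)` at the nodes gives `∑ |w j| ≤ ‖P‖`
(`sum_abs_le_norm`). So the ball lies in the affine image of `barycentricBall n ‖P‖`. Since the `w
j` sum to 1, the condition `∑ |w j| ≤ γ` bounds the negative part by `(γ - 1) / 2` and the positive
part by `(γ + 1) / 2`. Splitting by signs covers the set by products of two corner simplices, whose
volumes add up to `χ_n(γ) / n!` (`volume_barycentricBall_le`, `legendreChi_eq_sum`). Hence `vol B_n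
≤ χ_n(‖P‖) vol S`, and monotonicity of `χ_n` on `[1, ∞)` inverts this. -/

/-! ### Legendre polynomials on `[1, ∞)` -/

lemma Polynomial.iteratedDeriv_eval (p : Polynomial ℝ) (n : ℕ) :
    iteratedDeriv n (fun u => p.eval u) = fun u => (Polynomial.derivative^[n] p).eval u := by
  induction n with
  | zero => rfl
  | succ n ih =>
    rw [iteratedDeriv_succ, ih, Function.iterate_succ_apply']
    funext u
    rw [Polynomial.deriv]

-- Leibniz rule for `(u - 1)^n (u + 1)^n`. For `t ≥ 1` all terms are nonnegative, and they match the
-- volumes of the sign pieces.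
open Polynomial in
lemma legendreChi_eq_sum (n : ℕ) (t : ℝ) :
    legendreChi n t = ∑ k ∈ Finset.range (n + 1),
      (n.choose k : ℝ) ^ 2 * ((t - 1) / 2) ^ k * ((t + 1) / 2) ^ (n - k) := by
  have h1 : (fun u : ℝ => (u ^ 2 - 1) ^ n) =
      fun u => ((X - C (1 : ℝ)) ^ n * (X + C (1 : ℝ)) ^ n).eval u := by
    funext u
    simp only [eval_mul, eval_pow, eval_sub, eval_add, eval_X, eval_C, ← mul_pow]
    ring
  rw [legendreChi, h1, Polynomial.iteratedDeriv_eval,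
    iterate_derivative_mul]
  simp only [eval_finsetSum, Finset.mul_sum]
  refine Finset.sum_congr rfl fun k hk => ?_
  have hk : k ≤ n := Nat.lt_succ_iff.mp (Finset.mem_range.mp hk)
  rw [iterate_derivative_X_sub_pow, iterate_derivative_X_add_pow]
  simp only [nsmul_eq_mul, eval_mul, eval_pow, eval_sub, eval_add, eval_X, eval_C, eval_natCast,
    Nat.sub_sub_self hk]
  have e1 : (n.descFactorial (n - k) : ℝ) * k.factorial = n.factorial := by
    have := Nat.factorial_mul_descFactorial (Nat.sub_le n k)
    rw [Nat.sub_sub_self hk] at this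
    rw [mul_comm]; exact_mod_cast this
  have e2 : (n.descFactorial k : ℝ) = k.factorial * n.choose k := by
    exact_mod_cast Nat.descFactorial_eq_factorial_mul_choose n k
  have hkf : (k.factorial : ℝ) ≠ 0 := by positivity
  have hnf : (n.factorial : ℝ) ≠ 0 := by positivity
  have e3 : (n.descFactorial (n - k) : ℝ) = n.factorial / k.factorial := by
    field_simp; exact e1
  have e4 : (2 : ℝ) ^ n = 2 ^ k * 2 ^ (n - k) := by rw [← pow_add, Nat.add_sub_cancel' hk]
  rw [e2, e3, div_pow, div_pow, e4]
  field_simp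

lemma legendreChi_strictMonoOn {n : ℕ} (hn : 1 ≤ n) :
    StrictMonoOn (legendreChi n) (Set.Ici 1) := by
  intro a ha b hb hab
  have ha : (1 : ℝ) ≤ a := ha
  rw [legendreChi_eq_sum, legendreChi_eq_sum]
  have h0 : 0 ≤ (a - 1) / 2 := by linarith
  have h0' : 0 ≤ (a + 1) / 2 := by linarith
  refine Finset.sum_lt_sum (fun k _ => ?_) ⟨0, by simp, ?_⟩
  · have : 0 ≤ (b - 1) / 2 := by linarith
    gcongr
  · simp only [Nat.choose_zero_right, Nat.cast_one, one_pow, pow_zero, mul_one, one_mul,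
      Nat.sub_zero]
    exact pow_lt_pow_left₀ (by linarith) h0' (by omega)

lemma legendreChi_one (n : ℕ) : legendreChi n 1 = 1 := by
  rw [legendreChi_eq_sum, Finset.sum_eq_single 0]
  · norm_num
  · intro k _ hk
    simp [hk]
  · simp

lemma continuous_legendreChi (n : ℕ) : Continuous (legendreChi n) := by
  have : legendreChi n = _ := funext (legendreChi_eq_sum n)
  rw [this]
  fun_prop

/-- The term `k = 0` alone suffices; this growth feeds the intermediate value argument for
surjectivity. -/
lemma le_legendreChi {n : ℕ} (hn : 1 ≤ n) {t : ℝ} (ht : 1 ≤ t) :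
    (t + 1) / 2 ≤ legendreChi n t := by
  rw [legendreChi_eq_sum]
  have h0 : 0 ≤ (t - 1) / 2 := by linarith
  have h0' : 1 ≤ (t + 1) / 2 := by linarith
  refine le_trans ?_ (Finset.single_le_sum (fun k _ => by positivity)
    (Finset.mem_range.mpr n.succ_pos))
  simpa using le_self_pow₀ h0' (by omega : n ≠ 0)

lemma legendreChi_bijOn {n : ℕ} (hn : 1 ≤ n) :
    Set.BijOn (legendreChi n) (Set.Ici 1) (Set.Ici 1) := by
  have hmono := legendreChi_strictMonoOn hn
  refine ⟨fun t ht => ?_, hmono.injOn, fun s hs => ?_⟩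
  · have := hmono.monotoneOn Set.self_mem_Ici ht ht
    rwa [legendreChi_one] at this
  · have hs : (1 : ℝ) ≤ s := hs
    have hs' : s ∈ Set.Icc (legendreChi n 1) (legendreChi n (2 * s)) :=
      ⟨by rwa [legendreChi_one], by linarith [le_legendreChi hn (by linarith : 1 ≤ 2 * s)]⟩
    obtain ⟨t, ht, h⟩ := intermediate_value_Icc (by linarith : 1 ≤ 2 * s)
      (continuous_legendreChi n).continuousOn hs'
    exact ⟨t, ht.1, h⟩

lemma legendreChiInv_le {n : ℕ} (hn : 1 ≤ n) {s t : ℝ} (hs : 1 ≤ s) (ht : 1 ≤ t)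
    (h : s ≤ legendreChi n t) : legendreChiInv n s ≤ t := by
  have hex := (legendreChi_bijOn hn).surjOn hs
  refine ((legendreChi_strictMonoOn hn).le_iff_le (Function.invFunOn_mem hex) ht).1 ?_
  exact (Function.invFunOn_eq hex).trans_le h

/-! ### Volumes of corner simplices and of the barycentric ball -/

open MeasureTheory

/-- The simplex `{x : x ≥ 0, ∑ x_i ≤ r}` in `ℝ^ι`. -/
def cornerSimplex (ι : Type*) [Fintype ι] (r : ℝ) : Set (ι → ℝ) :=
  {x | (∀ i, 0 ≤ x i) ∧ ∑ i, x i ≤ r}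

lemma isClosed_cornerSimplex (ι : Type*) [Fintype ι] (r : ℝ) :
    IsClosed (cornerSimplex ι r) := by
  refine IsClosed.inter ?_ (isClosed_le (f := fun x : ι → ℝ => ∑ i, x i) (by fun_prop)
    continuous_const)
  change IsClosed {x : ι → ℝ | ∀ i, 0 ≤ x i}
  simp only [Set.ofPred_forall]
  exact isClosed_iInter fun i => isClosed_le continuous_const (continuous_apply i)

/-- Fubini in the first coordinate: the slice at `t ∈ [0, r]` is a corner simplex of size `r - t`,
and other slices are empty. -/
lemma volume_cornerSimplex_fin (k : ℕ) {r : ℝ} (hr : 0 ≤ r) :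
    volume (cornerSimplex (Fin k) r) = ENNReal.ofReal (r ^ k / k.factorial) := by
  induction k generalizing r with
  | zero =>
    have : cornerSimplex (Fin 0) r = Set.univ := by
      ext x; simp [cornerSimplex, hr]
    rw [this, volume_pi, Measure.pi_of_empty]
    simp
  | succ k ih =>
    have hmp := volume_preserving_piFinSuccAbove (fun _ : Fin (k + 1) => ℝ) 0
    set S : Set (ℝ × (Fin k → ℝ)) :=
      {p | 0 ≤ p.1 ∧ p.2 ∈ cornerSimplex (Fin k) (r - p.1)} with hS
    have hSeq : S = {p | 0 ≤ p.1} ∩ ({p | ∀ i, 0 ≤ p.2 i} ∩ {p | ∑ i, p.2 i ≤ r - p.1}) := rfl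
    have hSm : MeasurableSet S := by
      rw [hSeq]
      refine (IsClosed.inter (isClosed_le continuous_const continuous_fst) (IsClosed.inter ?_
        (isClosed_le (by fun_prop) (by fun_prop)))).measurableSet
      simp only [Set.ofPred_forall]
      exact isClosed_iInter fun i => isClosed_le continuous_const (by fun_prop)
    have hpre : cornerSimplex (Fin (k + 1)) r =
        MeasurableEquiv.piFinSuccAbove (fun _ : Fin (k + 1) => ℝ) 0 ⁻¹' S := by
      ext x
      simp only [cornerSimplex, hS, Set.mem_ofPred_eq, Set.mem_preimage,
        MeasurableEquiv.piFinSuccAbove_apply, Fin.insertNthEquiv_symm_apply, Fin.removeNth,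
        Fin.forall_fin_succ, Fin.sum_univ_succ, Fin.zero_succAbove, and_assoc, le_sub_iff_add_le']
    rw [hpre, hmp.measure_preimage hSm.nullMeasurableSet, Measure.volume_eq_prod,
      Measure.prod_apply hSm]
    have hslice : ∀ t : ℝ, volume (Prod.mk t ⁻¹' S) =
        (Set.Icc 0 r).indicator (fun t => ENNReal.ofReal ((r - t) ^ k / k.factorial)) t := by
      intro t
      by_cases ht : t ∈ Set.Icc 0 r
      · rw [Set.indicator_of_mem ht, ← ih (sub_nonneg.2 ht.2)]
        congr 1
        ext y
        simp [hS, ht.1]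
      · rw [Set.indicator_of_notMem ht]
        convert measure_empty (μ := (volume : Measure (Fin k → ℝ)))
        refine Set.eq_empty_of_forall_notMem fun y hy => ht ⟨hy.1, ?_⟩
        linarith [hy.2.2, Finset.sum_nonneg fun i (_ : i ∈ Finset.univ) => hy.2.1 i]
    simp_rw [hslice]
    rw [lintegral_indicator measurableSet_Icc, ← ofReal_integral_eq_lintegral_ofReal]
    · congr 1
      rw [integral_Icc_eq_integral_Ioc, ← intervalIntegral.integral_of_le hr,
        intervalIntegral.integral_div,
        intervalIntegral.integral_comp_sub_left (fun u => u ^ k) r, integral_pow]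
      simp only [sub_self, sub_zero, Nat.factorial_succ]
      push_cast
      field_simp
      simp
    · exact (Continuous.continuousOn (by fun_prop)).integrableOn_Icc
    · refine (ae_restrict_iff' measurableSet_Icc).2 (ae_of_all _ fun t ht => ?_)
      have : 0 ≤ r - t := sub_nonneg.2 ht.2
      simp only [Pi.zero_apply]
      positivity

lemma volume_cornerSimplex (ι : Type*) [Fintype ι] {r : ℝ} (hr : 0 ≤ r) :
    volume (cornerSimplex ι r) =
      ENNReal.ofReal (r ^ Fintype.card ι / (Fintype.card ι).factorial) := by
  rw [← volume_cornerSimplex_fin _ hr]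
  have hmp := volume_measurePreserving_piCongrLeft (fun _ : Fin (Fintype.card ι) => ℝ)
    (Fintype.equivFin ι)
  rw [← hmp.measure_preimage (isClosed_cornerSimplex _ r).measurableSet.nullMeasurableSet]
  congr 1
  ext x
  have h : ∀ i, MeasurableEquiv.piCongrLeft (fun _ : Fin (Fintype.card ι) => ℝ)
      (Fintype.equivFin ι) x i = x ((Fintype.equivFin ι).symm i) := fun i => by
    obtain ⟨j, rfl⟩ := (Fintype.equivFin ι).surjective i
    rw [MeasurableEquiv.piCongrLeft_apply_apply, Equiv.symm_apply_apply]
  simp only [cornerSimplex, Set.mem_ofPred_eq, Set.mem_preimage, h,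
    (Fintype.equivFin ι).symm.sum_comp, (Fintype.equivFin ι).symm.forall_congr_left]
  simp

/-- The product of a negated corner simplex in the coordinates in `s` with a corner simplex in
the other coordinates. -/
def signedCorner {n : ℕ} (s : Finset (Fin n)) (b c : ℝ) : Set (Fin n → ℝ) :=
  {x | ((∀ i : {i // i ∈ s}, 0 ≤ -x i) ∧ ∑ i : {i // i ∈ s}, -x i ≤ b) ∧
    ((∀ i : {i // i ∉ s}, 0 ≤ x i) ∧ ∑ i : {i // i ∉ s}, x i ≤ c)}

lemma volume_signedCorner {n : ℕ} (s : Finset (Fin n)) {b c : ℝ} (hb : 0 ≤ b) (hc : 0 ≤ c) :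
    volume (signedCorner s b c) =
      ENNReal.ofReal (b ^ s.card / s.card.factorial *
        (c ^ (n - s.card) / (n - s.card).factorial)) := by
  have hmp := volume_preserving_piEquivPiSubtypeProd (fun _ : Fin n => ℝ) (· ∈ s)
  have hpre : signedCorner s b c =
      MeasurableEquiv.piEquivPiSubtypeProd (fun _ : Fin n => ℝ) (· ∈ s) ⁻¹'
        ((-cornerSimplex {i // i ∈ s} b) ×ˢ cornerSimplex {i // i ∉ s} c) := by
    ext x
    rfl
  rw [hpre, hmp.measure_preimage, Measure.volume_eq_prod, Measure.prod_prod, Measure.measure_neg,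
    ENNReal.ofReal_mul (by positivity)]
  · have hB := volume_cornerSimplex {i // i ∈ s} hb
    have hC := volume_cornerSimplex {i // i ∉ s} hc
    rw [Fintype.card_coe] at hB
    rw [Fintype.card_subtype_compl, Fintype.card_coe, Fintype.card_fin] at hC
    convert congrArg₂ (· * ·) hB hC
  · exact ((isClosed_cornerSimplex _ _).neg.prod
      (isClosed_cornerSimplex _ _)).measurableSet.nullMeasurableSet

/-- The points of `ℝⁿ` whose barycentric coordinates with respect to the simplex with vertices
`0, e₁, …, e_n` have `ℓ¹` norm at most `γ`. -/
def barycentricBall (n : ℕ) (γ : ℝ) : Set (Fin n → ℝ) :=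
  {x | |1 - ∑ i, x i| + ∑ i, |x i| ≤ γ}

lemma barycentricBall_subset (n : ℕ) (γ : ℝ) :
    barycentricBall n γ ⊆
      ⋃ s : Finset (Fin n), signedCorner s ((γ - 1) / 2) ((γ + 1) / 2) := by
  classical
  intro x hx
  have hx : |1 - ∑ i, x i| + ∑ i, |x i| ≤ γ := hx
  set s : Finset (Fin n) := {i | x i < 0}
  have hs : ∀ i, i ∈ s ↔ x i < 0 := fun i => by simp [s]
  have h1 := Finset.sum_add_sum_compl s x
  have h2 := Finset.sum_add_sum_compl s fun i => |x i|
  have h3 : ∑ i ∈ s, |x i| = -∑ i ∈ s, x i := by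
    rw [← Finset.sum_neg_distrib]
    exact Finset.sum_congr rfl fun i hi => abs_of_neg ((hs i).1 hi)
  have h4 : ∑ i ∈ sᶜ, |x i| = ∑ i ∈ sᶜ, x i :=
    Finset.sum_congr rfl fun i hi => abs_of_nonneg (by simpa [hs] using hi)
  have e1 : ∑ i : {i // i ∈ s}, -x i = -∑ i ∈ s, x i := by
    rw [Finset.sum_neg_distrib, ← Finset.sum_coe_sort s x]
  have e2 : ∑ i : {i // i ∉ s}, x i = ∑ i ∈ sᶜ, x i :=
    (Finset.sum_subtype sᶜ (by simp) x).symm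
  refine Set.mem_iUnion.2 ⟨s, ⟨fun i => ?_, ?_⟩, fun i => ?_, ?_⟩
  · linarith [(hs i).1 i.2]
  · rw [e1]
    linarith [le_abs_self (1 - ∑ i, x i)]
  · exact not_lt.1 (mt (hs i).2 i.2)
  · rw [e2]
    linarith [neg_abs_le (1 - ∑ i, x i)]

lemma volume_barycentricBall_le (n : ℕ) {γ : ℝ} (hγ : 1 ≤ γ) :
    volume (barycentricBall n γ) ≤ ENNReal.ofReal (legendreChi n γ / n.factorial) := by
  have hb : 0 ≤ (γ - 1) / 2 := by linarith
  have hc : 0 ≤ (γ + 1) / 2 := by linarith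
  refine (measure_mono (barycentricBall_subset n γ)).trans
    ((measure_iUnion_fintype_le _ _).trans_eq ?_)
  simp_rw [volume_signedCorner _ hb hc]
  rw [← ENNReal.ofReal_sum_of_nonneg fun s _ => by positivity]
  congr 1
  -- Grouping the sign sets by cardinality yields one factor `n.choose k`; the second comes from `1
  -- / (k! (n - k)!)`.
  rw [← Finset.powerset_univ, Finset.sum_powerset_apply_card (fun k =>
    ((γ - 1) / 2) ^ k / k.factorial * (((γ + 1) / 2) ^ (n - k) / (n - k).factorial)),
    legendreChi_eq_sum, Finset.sum_div, Finset.card_univ, Fintype.card_fin]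
  refine Finset.sum_congr rfl fun k hk => ?_
  have hk : k ≤ n := Nat.lt_succ_iff.mp (Finset.mem_range.mp hk)
  rw [nsmul_eq_mul, Nat.cast_choose ℝ hk]
  field_simp

/-! ### Lower bound for the projector norm -/

/-- Degree at most 1 leaves only the constant monomial, handled by `hw`, and single variables,
handled by `hy`. -/
lemma apply_sum_smul_of_mem_linearPolys {n : ℕ} {f : C(unitBall n, ℝ)} (hf : f ∈ linearPolys n)
    {ι : Type*} [Fintype ι] (x : ι → unitBall n) (w : ι → ℝ) (hw : ∑ j, w j = 1)
    (y : unitBall n) (hy : (y : EuclideanSpace ℝ (Fin n)) = ∑ j, w j • (x j).1) :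
    f y = ∑ j, w j * f (x j) := by
  obtain ⟨p, hp, rfl⟩ := hf
  have hp : p.totalDegree ≤ 1 := (MvPolynomial.mem_restrictTotalDegree _ _ _).1 hp
  have hev : ∀ z : unitBall n, (MvPolynomial.aeval (R := ℝ) (coordFun n)).toLinearMap p z =
      ∑ m ∈ p.support, p.coeff m * ∏ i, (z.1 i) ^ m i := by
    intro z
    rw [AlgHom.toLinearMap_apply, MvPolynomial.aeval_def, MvPolynomial.eval₂_eq',
      ContinuousMap.sum_apply]
    refine Finset.sum_congr rfl fun m _ => ?_
    simp [coordFun, ContinuousMap.prod_apply]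
  simp_rw [hev, Finset.mul_sum]
  rw [Finset.sum_comm]
  refine Finset.sum_congr rfl fun m hm => ?_
  simp_rw [mul_left_comm _ (p.coeff m), ← Finset.mul_sum]
  congr 1
  have hdeg : m.degree ≤ 1 := (MvPolynomial.le_totalDegree hm).trans hp
  rcases Nat.le_one_iff_eq_zero_or_eq_one.1 hdeg with h | h
  · rw [Finsupp.degree_eq_zero_iff] at h
    simp [h, hw]
  · obtain ⟨i, rfl⟩ := (Finsupp.sum_eq_one_iff m).1 h
    have hpr : ∀ z : EuclideanSpace ℝ (Fin n), ∏ k, z k ^ (Finsupp.single i 1 k) = z i := by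
      intro z
      rw [Finset.prod_eq_single i]
      · simp
      · intro k _ hk
        simp [hk]
      · simp
    simp_rw [hpr, hy]
    simp

lemma IsInterpolationProjector.sum_abs_le_norm {n : ℕ} {P : C(unitBall n, ℝ) →L[ℝ] C(unitBall n, ℝ)}
    {x : Fin (n + 1) → unitBall n} (hP : IsInterpolationProjector P x) (w : Fin (n + 1) → ℝ)
    (hw : ∑ j, w j = 1) (y : unitBall n)
    (hy : (y : EuclideanSpace ℝ (Fin n)) = ∑ j, w j • (x j).1) :
    ∑ j, |w j| ≤ ‖P‖ := by
  have hinj : Function.Injective x := fun i j h =>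
    hP.nondegenerate.injective (congrArg Subtype.val h)
  have hemb : Topology.IsClosedEmbedding x :=
    Continuous.isClosedEmbedding continuous_of_discreteTopology hinj
  let σ : C(Fin (n + 1), ℝ) := ⟨fun j => (SignType.sign (w j) : ℝ), continuous_of_discreteTopology⟩
  -- Tietze extension of the signs from the nodes to the ball, with values kept in `[-1, 1]`.
  obtain ⟨f, hf, hfx⟩ := σ.exists_extension_forall_mem_of_isClosedEmbedding
    (t := Set.Icc (-1) 1) (fun j => by
      rcases lt_trichotomy (w j) 0 with h | h | h <;> simp [σ, h]) ⟨0, by simp⟩ hemb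
  have hf1 : ‖f‖ ≤ 1 := (ContinuousMap.norm_le _ zero_le_one).2 fun z => abs_le.2 (hf z)
  have hval : P f y = ∑ j, |w j| := by
    rw [apply_sum_smul_of_mem_linearPolys (hP.mem_linearPolys f) x w hw y hy]
    refine Finset.sum_congr rfl fun j _ => ?_
    rw [hP.interpolates, show f (x j) = σ j from congrFun hfx j]
    exact self_mul_sign (w j)
  calc ∑ j, |w j| = P f y := hval.symm
    _ ≤ ‖P f‖ := (le_abs_self _).trans ((P f).norm_coe_le_norm y)
    _ ≤ ‖P‖ * ‖f‖ := P.le_opNorm f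
    _ ≤ ‖P‖ := mul_le_of_le_one_right (ContinuousLinearMap.opNorm_nonneg P) hf1

/-! ### Affine transport and the volume of the simplex -/

/-- The affine map `ℝⁿ → ℝⁿ` that carries the simplex with vertices `0, e₁, …, e_n` to the
simplex with vertices `v 0, …, v n`. -/
def simplexMap {n : ℕ} (v : Fin (n + 1) → EuclideanSpace ℝ (Fin n)) (l : Fin n → ℝ) :
    EuclideanSpace ℝ (Fin n) :=
  (1 - ∑ i, l i) • v 0 + ∑ i, l i • v i.succ

/-- The matrix whose rows are the edges of the simplex at the vertex `v 0`. -/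
def edgeMatrix {n : ℕ} (v : Fin (n + 1) → EuclideanSpace ℝ (Fin n)) :
    Matrix (Fin n) (Fin n) ℝ :=
  Matrix.of fun i j => v i.succ j - v 0 j

open Matrix in
lemma simplexMap_eq {n : ℕ} (v : Fin (n + 1) → EuclideanSpace ℝ (Fin n)) (l : Fin n → ℝ) :
    simplexMap v l =
      WithLp.toLp 2 ((v 0).ofLp + Matrix.toLin' (edgeMatrix v)ᵀ l) := by
  ext j
  simp only [simplexMap, PiLp.add_apply, PiLp.smul_apply, smul_eq_mul, toLin'_apply,
    mulVec_transpose, Pi.add_apply, vecMul, dotProduct, edgeMatrix, of_apply, mul_sub,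
    Finset.sum_sub_distrib, ← Finset.sum_mul, WithLp.ofLp_sum, Finset.sum_apply, WithLp.ofLp_smul,
    Pi.smul_apply]
  ring

lemma volume_image_simplexMap {n : ℕ} (v : Fin (n + 1) → EuclideanSpace ℝ (Fin n))
    (s : Set (Fin n → ℝ)) :
    volume (simplexMap v '' s) = ENNReal.ofReal |(edgeMatrix v).det| * volume s := by
  have h : simplexMap v = WithLp.toLp 2 ∘ ((v 0).ofLp + ·) ∘ Matrix.toLin' (edgeMatrix v).transpose :=
    funext (simplexMap_eq v)
  rw [h, Set.image_comp, Set.image_comp,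
    ← (PiLp.volume_preserving_toLp (Fin n)).measure_preimage_emb
      (MeasurableEquiv.toLp 2 (Fin n → ℝ)).measurableEmbedding,
    Set.preimage_image_eq _ (WithLp.toLp_injective 2), Set.image_add_left, measure_preimage_add,
    Measure.addHaar_image_linearMap, LinearMap.det_toLin', Matrix.det_transpose]

lemma abs_det_verticesMatrix {n : ℕ} (x : Fin (n + 1) → unitBall n) :
    |(verticesMatrix x).det| = |(edgeMatrix fun j => (x j).1).det| := by
  -- Subtracting row 0 from the other rows turns the last column into the first unit vector;
  -- expansion along it leaves the edge matrix.
  set B : Matrix (Fin (n + 1)) (Fin (n + 1)) ℝ := Matrix.of fun i j =>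
    verticesMatrix x i j - (if i = 0 then 0 else 1) * verticesMatrix x 0 j with hB
  have hdet : (verticesMatrix x).det = B.det :=
    Matrix.det_eq_of_forall_row_eq_smul_add_const (fun i => if i = 0 then 0 else 1) 0 (by simp)
      fun i j => by simp [hB]
  rw [hdet, Matrix.det_succ_column B (Fin.last n), Finset.sum_eq_single 0]
  · have h1 : B 0 (Fin.last n) = 1 := by simp [hB, verticesMatrix]
    have h2 : B.submatrix (Fin.succAbove 0) (Fin.last n).succAbove =
        edgeMatrix fun j => (x j).1 := by
      ext i j
      simp [hB, verticesMatrix, edgeMatrix, Fin.succ_ne_zero]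
    rw [h1, h2, abs_mul, abs_mul, abs_pow]
    simp
  · intro i _ hi
    simp [hB, verticesMatrix, hi]
  · simp

lemma det_edgeMatrix_ne_zero {n : ℕ} {v : Fin (n + 1) → EuclideanSpace ℝ (Fin n)}
    (hv : AffineIndependent ℝ v) : (edgeMatrix v).det ≠ 0 := by
  rw [affineIndependent_iff_linearIndependent_vsub ℝ v 0] at hv
  have h1 := hv.comp (fun i : Fin n => (⟨i.succ, Fin.succ_ne_zero i⟩ : {j // j ≠ (0 : Fin (n + 1))}))
    fun i j h => by simpa using h
  have h2 := h1.map' (WithLp.linearEquiv 2 ℝ (Fin n → ℝ)).toLinearMap (LinearEquiv.ker _)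
  have h3 : LinearIndependent ℝ (edgeMatrix v).row := h2
  exact ((Matrix.isUnit_iff_isUnit_det _).1
    (Matrix.linearIndependent_rows_iff_isUnit.1 h3)).ne_zero

lemma simplexMap_surjective {n : ℕ} {v : Fin (n + 1) → EuclideanSpace ℝ (Fin n)}
    (hv : AffineIndependent ℝ v) : Function.Surjective (simplexMap v) := by
  intro y
  have hu : IsUnit (edgeMatrix v).transpose.det := by
    rw [Matrix.det_transpose]; exact (det_edgeMatrix_ne_zero hv).isUnit
  refine ⟨Matrix.mulVec (edgeMatrix v).transpose⁻¹ (y.ofLp - (v 0).ofLp), ?_⟩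
  rw [simplexMap_eq, Matrix.toLin'_apply, Matrix.mulVec_mulVec, Matrix.mul_nonsing_inv _ hu,
    Matrix.one_mulVec, add_sub_cancel]

lemma simplexMap_eq_sum {n : ℕ} (v : Fin (n + 1) → EuclideanSpace ℝ (Fin n)) (l : Fin n → ℝ) :
    simplexMap v l = ∑ j, (Fin.cons (1 - ∑ i, l i) l : Fin (n + 1) → ℝ) j • v j := by
  simp [simplexMap, Fin.sum_univ_succ]

lemma convex_cornerSimplex (ι : Type*) [Fintype ι] (r : ℝ) : Convex ℝ (cornerSimplex ι r) := by
  rintro p ⟨hp, hp'⟩ q ⟨hq, hq'⟩ a b ha hb hab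
  refine ⟨fun i => ?_, ?_⟩
  · have := hp i
    have := hq i
    simp only [Pi.add_apply, Pi.smul_apply, smul_eq_mul]
    positivity
  · simp only [Pi.add_apply, Pi.smul_apply, smul_eq_mul, Finset.sum_add_distrib, ← Finset.mul_sum]
    calc a * ∑ i, p i + b * ∑ i, q i ≤ a * r + b * r := by gcongr
      _ = r := by rw [← add_mul, hab, one_mul]

lemma convexHull_range_eq_image_simplexMap {n : ℕ} (v : Fin (n + 1) → EuclideanSpace ℝ (Fin n)) :
    convexHull ℝ (Set.range v) = simplexMap v '' cornerSimplex (Fin n) 1 := by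
  refine Set.Subset.antisymm (convexHull_min ?_ ?_) ?_
  · rintro _ ⟨j, rfl⟩
    refine Fin.cases ⟨0, by simp [cornerSimplex], by simp [simplexMap]⟩ (fun i => ?_) j
    refine ⟨Pi.single i 1, ⟨fun k => ?_, by simp⟩, ?_⟩
    · by_cases h : k = i
      · subst h; simp
      · simp [h]
    · simp [simplexMap, Pi.single_apply, ite_smul]
  · rintro _ ⟨p, hp, rfl⟩ _ ⟨q, hq, rfl⟩ a b ha hb hab
    refine ⟨a • p + b • q, convex_cornerSimplex _ _ hp hq ha hb hab, ?_⟩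
    have hb' : b = 1 - a := by linarith
    rw [simplexMap_eq, simplexMap_eq, simplexMap_eq, map_add, map_smul, map_smul, ← WithLp.toLp_smul,
      ← WithLp.toLp_smul, ← WithLp.toLp_add, hb']
    congr 1
    module
  · rintro _ ⟨l, hl, rfl⟩
    rw [simplexMap_eq_sum]
    refine (convex_convexHull ℝ _).sum_mem (fun j _ => ?_) ?_
      fun j _ => subset_convexHull ℝ _ ⟨j, rfl⟩
    · refine Fin.cases ?_ (fun i => ?_) j
      · simpa using hl.2
      · simpa using hl.1 i
    · simp [Fin.sum_univ_succ]

lemma vol_simplexOf {n : ℕ} (x : Fin (n + 1) → unitBall n) :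
    vol (simplexOf x) = |(verticesMatrix x).det| / n.factorial := by
  rw [vol, simplexOf, convexHull_range_eq_image_simplexMap, volume_image_simplexMap,
    volume_cornerSimplex_fin n zero_le_one, ← ENNReal.ofReal_mul (abs_nonneg _),
    ENNReal.toReal_ofReal (by positivity), abs_det_verticesMatrix, one_pow, mul_one_div]

/-! ### Volume comparison and conclusion -/

lemma IsInterpolationProjector.unitBall_subset {n : ℕ}
    {P : C(unitBall n, ℝ) →L[ℝ] C(unitBall n, ℝ)} {x : Fin (n + 1) → unitBall n}
    (hP : IsInterpolationProjector P x) :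
    unitBall n ⊆ simplexMap (fun j => (x j).1) '' barycentricBall n ‖P‖ := by
  intro y hy
  obtain ⟨l, rfl⟩ := simplexMap_surjective hP.nondegenerate y
  refine ⟨l, ?_, rfl⟩
  have := hP.sum_abs_le_norm (Fin.cons (1 - ∑ i, l i) l) (by simp [Fin.sum_univ_succ]) ⟨_, hy⟩
    (simplexMap_eq_sum (fun j => (x j).1) l)
  simpa [barycentricBall, Fin.sum_univ_succ] using this

lemma IsInterpolationProjector.one_le_norm {n : ℕ}
    {P : C(unitBall n, ℝ) →L[ℝ] C(unitBall n, ℝ)} {x : Fin (n + 1) → unitBall n}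
    (hP : IsInterpolationProjector P x) : 1 ≤ ‖P‖ := by
  -- Barycentric coordinates of the vertex `x 0` itself.
  have := hP.sum_abs_le_norm (Pi.single 0 1) (by simp) (x 0) (by simp [Pi.single_apply, ite_smul])
  refine le_trans ?_ this
  refine le_trans ?_ (Finset.abs_sum_le_sum_abs _ _)
  simp

lemma IsInterpolationProjector.vol_unitBall_le {n : ℕ}
    {P : C(unitBall n, ℝ) →L[ℝ] C(unitBall n, ℝ)} {x : Fin (n + 1) → unitBall n}
    (hP : IsInterpolationProjector P x) :
    vol (unitBall n) ≤ legendreChi n ‖P‖ * vol (simplexOf x) := by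
  have h := (measure_mono hP.unitBall_subset).trans_eq (volume_image_simplexMap _ _)
  have h' := h.trans (mul_le_mul_right (volume_barycentricBall_le n hP.one_le_norm) _)
  rw [← ENNReal.ofReal_mul (abs_nonneg _), ← abs_det_verticesMatrix] at h'
  have hχ : 0 ≤ legendreChi n ‖P‖ := by
    have := hP.one_le_norm
    have : 0 ≤ (‖P‖ - 1) / 2 := by linarith
    rw [legendreChi_eq_sum]
    positivity
  rw [vol_simplexOf]
  refine (ENNReal.toReal_le_of_le_ofReal (by positivity) h').trans_eq ?_
  ring

/-- The first two conjuncts say that `χ_n⁻¹` is a genuine function on `[1, ∞)` and that it is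
evaluated at a point of its domain. -/
theorem theorem11p3 (n : ℕ) (hn : 1 ≤ n)
    (P : C(unitBall n, ℝ) →L[ℝ] C(unitBall n, ℝ)) (x : Fin (n + 1) → unitBall n)
    (hP : IsInterpolationProjector P x) :
    Set.BijOn (legendreChi n) (Set.Ici 1) (Set.Ici 1) ∧
    1 ≤ vol (unitBall n) / vol (simplexOf x) ∧
    legendreChiInv n (vol (unitBall n) / vol (simplexOf x)) ≤ ‖P‖ ∧
    legendreChiInv n (vol (unitBall n) / vol (simplexOf x)) =
      legendreChiInv n
        ((n.factorial : ℝ) * vol (unitBall n) / |(verticesMatrix x).det|) := by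
  have hpos : 0 < vol (simplexOf x) := by
    have := abs_pos.2 (det_edgeMatrix_ne_zero hP.nondegenerate)
    rw [← abs_det_verticesMatrix] at this
    rw [vol_simplexOf]
    positivity
  have hsub : simplexOf x ⊆ unitBall n :=
    convexHull_min (Set.range_subset_iff.2 fun j => (x j).2) (convex_closedBall _ _)
  have hone : 1 ≤ vol (unitBall n) / vol (simplexOf x) := by
    rw [one_le_div hpos]
    exact ENNReal.toReal_mono measure_closedBall_lt_top.ne (measure_mono hsub)
  refine ⟨legendreChi_bijOn hn, hone, legendreChiInv_le hn hone hP.one_le_norm ?_, ?_⟩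
  · rw [div_le_iff₀ hpos]
    exact hP.vol_unitBall_le
  · rw [vol_simplexOf, div_div_eq_mul_div, mul_comm]
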